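/- For a real $d\times d$ matrix $A$ let $\mathfrak g_A=\mathbb R e_0\ltimes_A\mathbb R^d$ be the $(d+1)$-dimensional real Lie algebra with $[e_0,v]=Av$ and $[v,w]=0$ for $v,w\in\mathbb R^d$. A real Lie algebra is called almost abelian if it has an abelian ideal of codimension one. A complex structure on a real Lie algebra $\mathfrak g$ is a linear automorphism $j$ of the vector space $\mathfrak g$ with $j^2=-\mathrm{id}$ and $[x,y]+j([jx,y]+[x,jy])-[jx,jy]=0$ for all $x,y\in\mathfrak g$; a symplectic structure on $\mathfrak g$ is a non-degenerate alternating bilinear form $\omega$ on $\mathfrak g$ with $\omega([x,y],z)+\omega([y,z],x)+\omega([z,x],y)=0$ for all $x,y,z\in\mathfrak g$. Let $\mathcal J_n$ be the nilpotent $n\times n$ Jordan block (ones just below the diagonal, zeros elsewhere) and $0_t$ the $t\times t$ zero matrix. For integers $k\ge 1$, $n_1>\dots>n_k\ge 2$, $p_1,\dots,p_k>0$, $t\ge 0$ with $\sum_i n_ip_i+t=m$, a nilpotent matrix $M\in M(m,\mathbb R)$ is said to have $\Lambda(M)=(n_1,\dots,n_k;p_1,\dots,p_k;t)$ if $M$ is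 conjugate over $\mathbb R$ to $\mathcal J_{n_1}^{\oplus p_1}\oplus\dots\oplus\mathcal J_{n_k}^{\oplus p_k}\oplus 0_t$. **Corollary.** Up to isomorphism, the only $10$-dimensional nilpotent almost abelian real Lie algebra admitting neither a complex nor a symplectic structure is $\mathfrak g_M$ with $\Lambda(M)=(5,3;1,1;1)$. That is: there is a matrix $M\in M(9,\mathbb R)$ with $\Lambda(M)=(5,3;1,1;1)$ (for instance $M=\mathcal J_5\oplus\mathcal J_3\oplus 0_1$); and for every such $M$, the Lie algebra $\mathfrak g_M$ is $10$-dimensional, nilpotent and almost abelian and admits neither a complex nor a symplectic structure, and every $10$-dimensional nilpotent almost abelian real Lie algebra that admits neither a complex nor a symplectic structure is isomorphic to $\mathfrak g_M$. -/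

import Mathlib

/-- A complex structure on a real Lie algebra `g`: a linear endomorphism `j` with `j ^ 2 = -id`
(hence a linear automorphism) whose Nijenhuis tensor vanishes. -/
def IsComplexStructure (g : Type*) [LieRing g] [LieAlgebra ℝ g] (j : g →ₗ[ℝ] g) : Prop :=
  (∀ x, j (j x) = -x) ∧
    ∀ x y, ⁅x, y⁆ + j (⁅j x, y⁆ + ⁅x, j y⁆) - ⁅j x, j y⁆ = 0

/-- A symplectic structure on a real Lie algebra `g`: a closed non-degenerate `2`-form. -/
def IsSymplecticStructure (g : Type*) [LieRing g] [LieAlgebra ℝ g]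
    (ω : LinearMap.BilinForm ℝ g) : Prop :=
  ω.IsAlt ∧ ω.Nondegenerate ∧
    ∀ x y z, -(ω ⁅x, y⁆ z) - ω ⁅y, z⁆ x - ω ⁅z, x⁆ y = 0

/-- `g` admits a complex structure. -/
def AdmitsComplexStructure (g : Type*) [LieRing g] [LieAlgebra ℝ g] : Prop :=
  ∃ j : g →ₗ[ℝ] g, IsComplexStructure g j

/-- `g` admits a symplectic structure. -/
def AdmitsSymplecticStructure (g : Type*) [LieRing g] [LieAlgebra ℝ g] : Prop :=
  ∃ ω : LinearMap.BilinForm ℝ g, IsSymplecticStructure g ω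

/-- A Lie algebra is almost abelian if it has an abelian ideal of codimension one. -/
def IsAlmostAbelian (g : Type*) [LieRing g] [LieAlgebra ℝ g] : Prop :=
  ∃ h : LieIdeal ℝ g, IsLieAbelian h ∧ Module.finrank ℝ (g ⧸ h) = 1

/-- The underlying vector space of `g_A = ℝ e₀ ⋉_A ℝ ^ d`; the pair `(s, v)` is `s e₀ + v`. -/
def AlmostAbelianAlg {d : ℕ} (_A : Matrix (Fin d) (Fin d) ℝ) : Type :=
  ℝ × (Fin d → ℝ)

namespace AlmostAbelianAlg

variable {d : ℕ} (A : Matrix (Fin d) (Fin d) ℝ)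

noncomputable instance : AddCommGroup (AlmostAbelianAlg A) :=
  inferInstanceAs (AddCommGroup (ℝ × (Fin d → ℝ)))

noncomputable instance : Module ℝ (AlmostAbelianAlg A) :=
  inferInstanceAs (Module ℝ (ℝ × (Fin d → ℝ)))

/-- The bracket of `g_A`, determined by `[e₀, v] = A v` and `[v, w] = 0` for `v, w ∈ ℝ ^ d`. -/
noncomputable instance : Bracket (AlmostAbelianAlg A) (AlmostAbelianAlg A) where
  bracket x y := ((0 : ℝ), x.1 • A.mulVec y.2 - y.1 • A.mulVec x.2)

variable {A} in
@[simp] theorem fst_lie (x y : AlmostAbelianAlg A) : ⁅x, y⁆.1 = 0 := rfl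

variable {A} in
@[simp] theorem snd_lie (x y : AlmostAbelianAlg A) :
    ⁅x, y⁆.2 = x.1 • A.mulVec y.2 - y.1 • A.mulVec x.2 := rfl

variable {A} in
@[simp] theorem fst_add (x y : AlmostAbelianAlg A) : (x + y).1 = x.1 + y.1 := rfl

variable {A} in
@[simp] theorem snd_add (x y : AlmostAbelianAlg A) : (x + y).2 = x.2 + y.2 := rfl

variable {A} in
@[simp] theorem fst_smul (c : ℝ) (x : AlmostAbelianAlg A) : (c • x).1 = c * x.1 := rfl

variable {A} in
@[simp] theorem snd_smul (c : ℝ) (x : AlmostAbelianAlg A) : (c • x).2 = c • x.2 := rfl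

noncomputable instance : LieRing (AlmostAbelianAlg A) where
  add_lie x y z := by
    refine Prod.ext ?_ ?_
    · simp
    · simp only [snd_lie, fst_add, snd_add, Matrix.mulVec_add, add_smul, smul_add]
      abel
  lie_add x y z := by
    refine Prod.ext ?_ ?_
    · simp
    · simp only [snd_lie, fst_add, snd_add, Matrix.mulVec_add, add_smul, smul_add]
      abel
  lie_self x := by
    refine Prod.ext rfl ?_
    exact sub_self _
  leibniz_lie x y z := by
    refine Prod.ext ?_ ?_
    · simp
    · simp only [fst_lie, snd_lie, snd_add, Matrix.mulVec_sub, Matrix.mulVec_smul, smul_sub,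
        zero_smul, smul_smul, mul_comm]
      abel

noncomputable instance : LieAlgebra ℝ (AlmostAbelianAlg A) where
  lie_smul c x y := by
    refine Prod.ext ?_ ?_
    · simp
    · simp only [snd_lie, fst_smul, snd_smul, Matrix.mulVec_smul, smul_sub, smul_smul, mul_comm]

end AlmostAbelianAlg

/-- The tuples of integers that label nilpotent Jordan forms: `blocks [(n₁, p₁), …, (nₖ, pₖ)] t`
is `(n₁, …, nₖ; p₁, …, pₖ; t)` and `zero m` is the one-term tuple `(m)`. -/
inductive JordanTuple where
  | blocks (l : List (ℕ × ℕ)) (t : ℕ) : JordanTuple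
  | zero (m : ℕ) : JordanTuple

/-- Membership in the set `⋀_m` of tuples of total size `m`. -/
def JordanTuple.Mem (m : ℕ) : JordanTuple → Prop
  | .blocks l t =>
      l ≠ [] ∧ l.Pairwise (fun a b => b.1 < a.1) ∧ (∀ a ∈ l, 2 ≤ a.1 ∧ 0 < a.2) ∧
        (l.map fun a => a.1 * a.2).sum + t = m
  | .zero s => s = m

/-- The list of the sizes of the Jordan blocks: each `nᵢ` occurs `pᵢ` times, and `0_t` is counted
as `t` blocks of size one. -/
def JordanTuple.sizes : JordanTuple → List ℕ
  | .blocks l t => (l.flatMap fun a => List.replicate a.2 a.1) ++ List.replicate t 1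
  | .zero m => List.replicate m 1

/-- The nilpotent Jordan block of size `n`, with ones just below the diagonal. -/
def jordanBlock (n : ℕ) : Matrix (Fin n) (Fin n) ℝ :=
  Matrix.of fun i j => if (i : ℕ) = (j : ℕ) + 1 then 1 else 0

/-- The direct sum of the nilpotent Jordan blocks whose sizes are the entries of a list. -/
def jordanSum (l : List ℕ) :
    Matrix ((i : Fin l.length) × Fin (l.get i)) ((i : Fin l.length) × Fin (l.get i)) ℝ :=
  Matrix.blockDiagonal' fun i => jordanBlock (l.get i)

/-- `Λ(M) = τ`: the tuple `τ` belongs to `⋀_m`, and `M` is conjugate to the nilpotent Jordan form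
`J_{n₁}^{⊕ p₁} ⊕ ⋯ ⊕ J_{nₖ}^{⊕ pₖ} ⊕ 0_t` (or `0_m`) which `τ` describes. The bijection `e` only
numbers the rows and columns of that block diagonal matrix by `Fin m`. -/
def HasLambda {m : ℕ} (M : Matrix (Fin m) (Fin m) ℝ) (τ : JordanTuple) : Prop :=
  τ.Mem m ∧
    ∃ (e : ((i : Fin τ.sizes.length) × Fin (τ.sizes.get i)) ≃ Fin m)
      (P : Matrix.GeneralLinearGroup (Fin m) ℝ),
      M = (P : Matrix (Fin m) (Fin m) ℝ) * Matrix.reindex e e (jordanSum τ.sizes) *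
        ((P⁻¹ : Matrix.GeneralLinearGroup (Fin m) ℝ) : Matrix (Fin m) (Fin m) ℝ)

/-- A `10`-dimensional nilpotent almost abelian real Lie algebra that admits neither a complex nor
a symplectic structure. -/
def IsTenDimWithoutStructures (g : Type*) [LieRing g] [LieAlgebra ℝ g] : Prop :=
  Module.finrank ℝ g = 10 ∧ LieRing.IsNilpotent g ∧ IsAlmostAbelian g ∧
    ¬ AdmitsComplexStructure g ∧ ¬ AdmitsSymplecticStructure g

/-! For block sizes `5, 3, 1`, the second, third and fourth powers of the matrix have ranks 4, 2 and
1, and parity excludes both structures. A symplectic form restricts to an alternating form `B` on `ℝ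
^ 9` with radical of dimension at most one, for which `f = A` is skew. Then `B (f² ·, ·)` and `B (f⁴
·, ·)` are alternating, hence of even rank. The second must vanish, so the radical is the range of
`f⁴`, and the first has rank 4 - 1 = 3 (`not_skew_of_finrank_range`). A complex structure leaves
invariant a hyperplane of `ℝ ^ 9` and commutes with `f` there, so the powers of `f` map this
hyperplane to even-dimensional spaces. The image under `f³` must be the whole range of `f³`, and
then that under `f⁴` is a line (`not_commute_of_finrank_range`). Conversely, every other nilpotent
Jordan type in dimension 9 is symplectic. Blocks of equal odd size can be paired off until the
remaining odd sizes are distinct. These have odd sum at most 9, so there is a single one or they are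
`5, 3, 1`. In the first case an explicit form pairs the chains
(`IsJordanBasis.admitsSymplecticStructure`); in the second the blocks fill dimension 9 and fix the
algebra up to isomorphism. -/

/-! ### Jordan bases of nilpotent endomorphisms. -/

/-- A Jordan basis of a nilpotent endomorphism `f`: the basis is cut into chains of lengths `k i`,
and `f` moves each vector to the next vector of its chain, the last one to `0`. -/
def IsJordanBasis {ι V : Type*} [AddCommGroup V] [Module ℝ V] {k : ι → ℕ} (f : V →ₗ[ℝ] V)
    (b : Module.Basis ((i : ι) × Fin (k i)) ℝ V) : Prop :=
  ∀ i (j : Fin (k i)), f (b ⟨i, j⟩) = if h : (j : ℕ) + 1 < k i then b ⟨i, ⟨j + 1, h⟩⟩ else 0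

open Polynomial in
/-- The powers of `X` form a basis of `ℝ[X] ⧸ (X ^ n)`. -/
theorem exists_basis_quotient_X_pow (n : ℕ) :
    ∃ b : Module.Basis (Fin n) ℝ (ℝ[X] ⧸ (Submodule.span ℝ[X] {(X : ℝ[X]) ^ n})),
      ∀ j, b j = Submodule.Quotient.mk (X ^ (j : ℕ)) := by
  -- `AdjoinRoot` is by definition the same quotient, and it has a power basis.
  have key : ∃ b : Module.Basis (Fin n) ℝ (AdjoinRoot ((X : ℝ[X]) ^ n)),
      ∀ j, b j = AdjoinRoot.mk _ (X ^ (j : ℕ)) := by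
    refine ⟨(AdjoinRoot.powerBasis' (monic_X_pow (R := ℝ) n)).basis.reindex
      (finCongr (natDegree_X_pow n)), fun j => ?_⟩
    rw [Module.Basis.reindex_apply, PowerBasis.basis_eq_pow, AdjoinRoot.powerBasis'_gen, map_pow,
      AdjoinRoot.mk_X]
    rfl
  exact key

open Polynomial in
/-- Every nilpotent endomorphism of a finite-dimensional real space has a Jordan basis. -/
theorem exists_isJordanBasis {V : Type*} [AddCommGroup V] [Module ℝ V] [Module.Finite ℝ V]
    (f : V →ₗ[ℝ] V) (hf : IsNilpotent f) :
    ∃ (d : ℕ) (k : Fin d → ℕ) (b : Module.Basis ((i : Fin d) × Fin (k i)) ℝ V),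
      IsJordanBasis f b := by
  obtain ⟨n, hn⟩ := hf
  -- With `X` acting as `f`, nilpotency means `X`-power torsion, so the structure theorem over the
  -- principal ideal domain `ℝ[X]` applies.
  have htors : Module.IsTorsion' (Module.AEval' f) (Submonoid.powers (X : ℝ[X])) := by
    intro x
    refine ⟨⟨X ^ n, n, rfl⟩, ?_⟩
    obtain ⟨y, rfl⟩ := (Module.AEval'.of f).surjective x
    change (X ^ n : ℝ[X]) • Module.AEval'.of f y = 0
    rw [Module.AEval'.X_pow_smul_of, hn]
    simp
  have : Module.Finite ℝ[X] (Module.AEval' f) := inferInstance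
  obtain ⟨d, k, ⟨e⟩⟩ := Module.torsion_by_prime_power_decomposition
    (p := (X : ℝ[X])) irreducible_X htors
  refine ⟨d, k, ?_⟩
  choose b₀ hb₀ using fun i => exists_basis_quotient_X_pow (k i)
  let b₁ : Module.Basis ((i : Fin d) × Fin (k i)) ℝ
    (DirectSum (Fin d) fun i => ℝ[X] ⧸ (Submodule.span ℝ[X] {(X : ℝ[X]) ^ k i})) :=
    DFinsupp.basis b₀
  have hb₁ : ∀ i j, b₁ ⟨i, j⟩ = DirectSum.lof ℝ[X] (Fin d) _ i (b₀ i j) := by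
    intro i j
    apply b₁.repr.injective
    rw [Module.Basis.repr_self]
    ext ⟨i', j'⟩
    change _ = (b₀ i').repr (DirectSum.lof ℝ[X] (Fin d)
      (fun i => ℝ[X] ⧸ (Submodule.span ℝ[X] {(X : ℝ[X]) ^ k i})) i (b₀ i j) i') j'
    by_cases h : i = i'
    · subst h
      rw [DirectSum.lof_apply, Module.Basis.repr_self]
      simp [Finsupp.single_apply]
    · rw [DirectSum.lof_eq_of, DirectSum.of_eq_of_ne _ _ _ (Ne.symm h)]
      simp [h]
  let e' := (Module.AEval'.of f) ≪≫ₗ (e.restrictScalars ℝ)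
  have he' : ∀ x, e' (f x) = (X : ℝ[X]) • e' x := by
    intro x
    simp only [e', LinearEquiv.trans_apply, LinearEquiv.restrictScalars_apply]
    rw [← map_smul, Module.AEval'.X_smul_of]
  refine ⟨b₁.map e'.symm, ?_⟩
  intro i j
  apply e'.injective
  rw [he', Module.Basis.map_apply, LinearEquiv.apply_symm_apply, hb₁, hb₀, ← map_smul,
    ← Submodule.Quotient.mk_smul, smul_eq_mul, ← pow_succ']
  split_ifs with h
  · rw [Module.Basis.map_apply, LinearEquiv.apply_symm_apply, hb₁, hb₀]
  · have : k i = j + 1 := by omega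
    rw [← this, (Submodule.Quotient.mk_eq_zero _).2 (Submodule.mem_span_singleton_self _)]
    simp

namespace IsJordanBasis

variable {ι V : Type*} [AddCommGroup V] [Module ℝ V] {k : ι → ℕ} {f : V →ₗ[ℝ] V}
  {b : Module.Basis ((i : ι) × Fin (k i)) ℝ V}

theorem pow_apply (hb : IsJordanBasis f b) (m : ℕ) (i : ι) (j : Fin (k i)) :
    (f ^ m) (b ⟨i, j⟩) = if h : (j : ℕ) + m < k i then b ⟨i, ⟨j + m, h⟩⟩ else 0 := by
  induction m with
  | zero => simp
  | succ m ih =>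
    rw [pow_succ', Module.End.mul_apply, ih]
    by_cases h : (j : ℕ) + m < k i
    · rw [dif_pos h, hb]
      rfl
    · rw [dif_neg h, dif_neg (by omega), map_zero]

theorem range_pow (hb : IsJordanBasis f b) (m : ℕ) :
    LinearMap.range (f ^ m) =
      Submodule.span ℝ (Set.range fun p : {p : (i : ι) × Fin (k i) // m ≤ (p.2 : ℕ)} => b p.1) := by
  apply le_antisymm
  · rw [LinearMap.range_eq_map, ← b.span_eq, Submodule.map_span, Submodule.span_le]
    rintro _ ⟨_, ⟨⟨i, j⟩, rfl⟩, rfl⟩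
    rw [hb.pow_apply]
    split_ifs with h
    · exact Submodule.subset_span ⟨⟨⟨i, ⟨j + m, h⟩⟩, by simp⟩, rfl⟩
    · exact Submodule.zero_mem _
  · rw [Submodule.span_le]
    rintro _ ⟨⟨⟨i, j⟩, h⟩, rfl⟩
    refine ⟨b ⟨i, ⟨j - m, by omega⟩⟩, ?_⟩
    rw [hb.pow_apply, dif_pos (by dsimp only at h ⊢; omega)]
    congr
    dsimp only at h ⊢
    omega

/-- The basis vectors at positions at least `m` span the range; truncated subtraction makes chains
shorter than `m` count as zero. These ranks are all that the nonexistence proofs use of the Jordan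
type. -/
theorem finrank_range_pow [Fintype ι] (hb : IsJordanBasis f b) (m : ℕ) :
    Module.finrank ℝ (LinearMap.range (f ^ m)) = ∑ i, (k i - m) := by
  rw [hb.range_pow, finrank_span_eq_card]
  · have e : {p : (i : ι) × Fin (k i) // m ≤ (p.2 : ℕ)} ≃ (i : ι) × Fin (k i - m) :=
      { toFun p := ⟨p.1.1, ⟨p.1.2 - m, by have := p.1.2.2; have := p.2; omega⟩⟩
        invFun q := ⟨⟨q.1, ⟨q.2 + m, by have := q.2.2; omega⟩⟩, by simp⟩
        left_inv := by
          rintro ⟨⟨i, j, hj⟩, h⟩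
          simp only [Subtype.mk.injEq, Sigma.mk.injEq, heq_eq_eq, true_and, Fin.mk.injEq]
          dsimp only at h
          omega
        right_inv := by
          rintro ⟨i, j, hj⟩
          simp }
    rw [Fintype.card_congr e, Fintype.card_sigma]
    simp
  · exact b.linearIndependent.comp _ Subtype.val_injective

theorem isNilpotent [Finite ι] (hb : IsJordanBasis f b) : IsNilpotent f := by
  cases nonempty_fintype ι
  refine ⟨∑ i, k i, b.ext fun ⟨i, j⟩ => ?_⟩
  rw [hb.pow_apply, dif_neg, LinearMap.zero_apply]
  have := Finset.single_le_sum (f := k) (fun _ _ => Nat.zero_le _) (Finset.mem_univ i)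
  omega

/-- Endomorphisms with Jordan bases of the same shape are conjugate. -/
theorem equiv_apply {W : Type*} [AddCommGroup W] [Module ℝ W] {g : W →ₗ[ℝ] W}
    {c : Module.Basis ((i : ι) × Fin (k i)) ℝ W} (hb : IsJordanBasis f b) (hc : IsJordanBasis g c)
    (x : V) : b.equiv c (Equiv.refl _) (f x) = g (b.equiv c (Equiv.refl _) x) := by
  suffices h : (b.equiv c (Equiv.refl _)).toLinearMap ∘ₗ f =
      g ∘ₗ (b.equiv c (Equiv.refl _)).toLinearMap from LinearMap.congr_fun h x
  refine b.ext fun ⟨i, j⟩ => ?_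
  simp only [LinearMap.comp_apply, LinearEquiv.coe_coe, Module.Basis.equiv_apply, Equiv.refl_apply,
    hb i j, hc i j]
  split_ifs <;> simp

/-- A Jordan basis stays one when the chains are selected and renumbered, provided that only
chains of length zero are left out. -/
theorem exists_comp {κ : Type*} [Fintype κ] [Fintype ι] (hb : IsJordanBasis f b) (s : κ → ι)
    (hs : Function.Injective s) {l : κ → ℕ} (hl : ∀ a, k (s a) = l a)
    (hsum : ∑ a, l a = ∑ i, k i) :
    ∃ c : Module.Basis ((a : κ) × Fin (l a)) ℝ V, IsJordanBasis f c := by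
  obtain rfl : (fun a => k (s a)) = l := funext hl
  let t : ((a : κ) × Fin (k (s a))) → ((i : ι) × Fin (k i)) := fun p => ⟨s p.1, p.2⟩
  have ht : Function.Injective t := by
    rintro ⟨a, j⟩ ⟨a', j'⟩ h
    obtain rfl : a = a' := hs (congrArg Sigma.fst h)
    simpa [t] using h
  have hbij : Function.Bijective t := by
    rw [Fintype.bijective_iff_injective_and_card]
    exact ⟨ht, by simpa using hsum⟩
  refine ⟨b.reindex (Equiv.ofBijective t hbij).symm, fun a j => ?_⟩
  simp only [Module.Basis.reindex_apply, Equiv.symm_symm, Equiv.ofBijective_apply, t]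
  exact hb (s a) j

end IsJordanBasis

/-- The columns of a conjugating matrix form a Jordan basis. -/
theorem exists_isJordanBasis_of_conj {m : ℕ} (l : List ℕ)
    (e : ((i : Fin l.length) × Fin (l.get i)) ≃ Fin m) (P : Matrix.GeneralLinearGroup (Fin m) ℝ)
    {M : Matrix (Fin m) (Fin m) ℝ}
    (hM : M = (P : Matrix (Fin m) (Fin m) ℝ) * Matrix.reindex e e (jordanSum l) *
        ((P⁻¹ : Matrix.GeneralLinearGroup (Fin m) ℝ) : Matrix (Fin m) (Fin m) ℝ)) :
    ∃ b : Module.Basis ((i : Fin l.length) × Fin (l.get i)) ℝ (Fin m → ℝ),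
      IsJordanBasis M.mulVecLin b := by
  let φ : (Fin m → ℝ) ≃ₗ[ℝ] (Fin m → ℝ) :=
    LinearEquiv.ofLinearMap (P : Matrix (Fin m) (Fin m) ℝ).mulVecLin
      ((P⁻¹ : Matrix.GeneralLinearGroup (Fin m) ℝ) : Matrix (Fin m) (Fin m) ℝ).mulVecLin
      (by rw [← Matrix.mulVecLin_mul, ← Units.val_mul]; simp)
      (by rw [← Matrix.mulVecLin_mul, ← Units.val_mul]; simp)
  let b := ((Pi.basisFun ℝ (Fin m)).reindex e.symm).map φ
  have hb : ∀ p, b p = (P : Matrix (Fin m) (Fin m) ℝ).mulVec (Pi.single (e p) 1) := fun p => by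
    simp [b, φ, Module.Basis.map_apply, LinearEquiv.coe_ofLinearMap]
  refine ⟨b, fun i j => ?_⟩
  have h1 : (Matrix.reindex e e (jordanSum l)).mulVec (Pi.single (e ⟨i, j⟩) 1) =
      if h : (j : ℕ) + 1 < l.get i then Pi.single (e ⟨i, ⟨j + 1, h⟩⟩) 1 else 0 := by
    ext r
    obtain ⟨⟨i', j'⟩, rfl⟩ := e.surjective r
    rw [Matrix.mulVec_single_one]
    simp only [Matrix.col_apply, Matrix.reindex_apply, Matrix.submatrix_apply,
      Equiv.symm_apply_apply, jordanSum, Matrix.blockDiagonal'_apply, jordanBlock, Matrix.of_apply]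
    by_cases hi : i' = i
    · subst hi
      simp only [dite_true, cast_eq]
      split_ifs with h1 h2 h2
      · obtain rfl : j' = ⟨j + 1, h2⟩ := Fin.ext h1
        simp
      · omega
      · rw [Pi.single_apply, if_neg]
        intro h
        have := e.injective h
        simp only [Sigma.mk.injEq, heq_eq_eq, true_and] at this
        exact h1 (by rw [this])
      · rfl
    · rw [dif_neg hi]
      split_ifs with h2
      · rw [Pi.single_apply, if_neg]
        intro h
        exact hi (congrArg Sigma.fst (e.injective h))
      · rfl
  rw [hM, Matrix.mulVecLin_apply, hb, ← Matrix.mulVec_mulVec, ← Matrix.mulVec_mulVec,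
    Matrix.mulVec_mulVec (Pi.single _ _), ← Units.val_mul]
  simp only [inv_mul_cancel, Units.val_one, Matrix.one_mulVec, h1]
  split_ifs with h
  · rw [hb]
  · simp

/-! ### Parity obstructions from linear algebra. -/

/-- A subspace invariant under a linear map which squares to `-1` on it is even-dimensional. -/
theorem even_finrank_of_apply_apply_eq_neg {V : Type*} [AddCommGroup V] [Module ℝ V]
    [Module.Finite ℝ V] (J : V →ₗ[ℝ] V) (S : Submodule ℝ V) (hS : ∀ x ∈ S, J x ∈ S)
    (hJ : ∀ x ∈ S, J (J x) = -x) : Even (Module.finrank ℝ S) := by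
  have h : J.restrict hS * J.restrict hS = (-1 : ℝ) • LinearMap.id := by
    ext x
    simp [hJ x x.2]
  -- The square of a real determinant equals `(-1) ^ n`, so `n` cannot be odd.
  have h2 := congrArg LinearMap.det h
  rw [map_mul, LinearMap.det_smul, LinearMap.det_id, mul_one] at h2
  by_contra hodd
  rw [Nat.not_even_iff_odd] at hodd
  rw [hodd.neg_one_pow] at h2
  nlinarith [mul_self_nonneg (LinearMap.det (J.restrict hS))]

/-- The Gram matrix is skew and invertible, and transposition multiplies its determinant by `(-1) ^
n`. -/
theorem LinearMap.BilinForm.IsAlt.even_finrank {V : Type*} [AddCommGroup V] [Module ℝ V]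
    [Module.Finite ℝ V] {B : LinearMap.BilinForm ℝ V} (hB : B.IsAlt) (hker : LinearMap.ker B = ⊥) :
    Even (Module.finrank ℝ V) := by
  have hnd : B.Nondegenerate :=
    hB.isRefl.nondegenerate_iff_separatingLeft.2 (LinearMap.separatingLeft_iff_ker_eq_bot.2 hker)
  let b := Module.finBasis ℝ V
  let G := BilinForm.toMatrix b B
  have hdet : G.det ≠ 0 := by
    rw [← Matrix.nondegenerate_iff_det_ne_zero]
    exact (LinearMap.BilinForm.nondegenerate_toMatrix_iff b).2 hnd
  have hG : G.transpose = -G := by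
    ext i j
    simp only [G, Matrix.transpose_apply, Matrix.neg_apply, BilinForm.toMatrix_apply]
    exact (hB.neg_eq _ _).symm
  have h := congrArg Matrix.det hG
  rw [Matrix.det_transpose, Matrix.det_neg, Fintype.card_fin] at h
  by_contra hodd
  rw [Nat.not_even_iff_odd] at hodd
  rw [hodd.neg_one_pow] at h
  exact hdet (by linarith)

/-- The rank of an alternating form is even. -/
theorem LinearMap.BilinForm.IsAlt.even_finrank_range {V : Type*} [AddCommGroup V] [Module ℝ V]
    [Module.Finite ℝ V] {B : LinearMap.BilinForm ℝ V} (hB : B.IsAlt) :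
    Even (Module.finrank ℝ (LinearMap.range B)) := by
  obtain ⟨W, hW⟩ := (LinearMap.ker B).exists_isCompl
  have h1 := Submodule.finrank_add_eq_of_isCompl hW
  have h2 := LinearMap.finrank_range_add_finrank_ker B
  have h3 : Module.finrank ℝ (LinearMap.range B) = Module.finrank ℝ W := by omega
  rw [h3]
  -- The form is nondegenerate on a complement of its radical, whose dimension is the rank.
  refine LinearMap.BilinForm.IsAlt.even_finrank (B := B.restrict W) (fun x => hB x) ?_
  rw [LinearMap.ker_eq_bot']
  intro x hx
  have hx' : (x : V) ∈ LinearMap.ker B := by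
    rw [LinearMap.mem_ker]
    ext y
    have hy : y ∈ LinearMap.ker B ⊔ W := by rw [hW.sup_eq_top]; trivial
    obtain ⟨u, hu, w, hw, rfl⟩ := Submodule.mem_sup.1 hy
    have hxw : B x w = 0 := LinearMap.congr_fun hx ⟨w, hw⟩
    have hxu : B x u = 0 := by rw [← hB.neg_eq, LinearMap.mem_ker.1 hu]; simp
    simp [hxw, hxu]
  have := hW.disjoint.le_bot ⟨hx', x.2⟩
  exact Subtype.ext this

/-- If `f ^ 2` and `f ^ 4` have ranks `4` and `1`, then `f` is not skew for an alternating form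
whose radical is at most one-dimensional. -/
theorem not_skew_of_finrank_range {V : Type*} [AddCommGroup V] [Module ℝ V]
    [Module.Finite ℝ V] {B : LinearMap.BilinForm ℝ V} (hB : B.IsAlt)
    (hker : Module.finrank ℝ (LinearMap.ker B) ≤ 1) {f : V →ₗ[ℝ] V}
    (h2 : Module.finrank ℝ (LinearMap.range (f ^ 2)) = 4)
    (h4 : Module.finrank ℝ (LinearMap.range (f ^ 4)) = 1) :
    ¬ ∀ v w, B (f v) w + B v (f w) = 0 := by
  intro hf
  have hf' : ∀ v w, B (f v) w = - B v (f w) := fun v w => by linarith [hf v w]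
  have halt2 : LinearMap.BilinForm.IsAlt (B ∘ₗ (f ^ 2)) := fun v => by
    change B ((f ^ 2) v) v = 0
    rw [pow_two, Module.End.mul_apply, hf', hB, neg_zero]
  have halt4 : LinearMap.BilinForm.IsAlt (B ∘ₗ (f ^ 4)) := fun v => by
    change B ((f ^ 4) v) v = 0
    simp only [pow_succ, pow_zero, one_mul, Module.End.mul_apply]
    rw [hf', hf', hB, neg_zero, neg_zero]
  have e2 := halt2.even_finrank_range
  have e4 := halt4.even_finrank_range
  rw [LinearMap.range_comp] at e2 e4
  -- The rank of `B ∘ₗ f ^ 4` is even and at most 1, hence zero.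
  have hle : LinearMap.range (f ^ 4) ≤ LinearMap.ker B := by
    have h := Submodule.finrank_map_le B (LinearMap.range (f ^ 4))
    have h0 : Module.finrank ℝ (Submodule.map B (LinearMap.range (f ^ 4))) = 0 := by
      obtain ⟨c, hc⟩ := e4
      omega
    rw [Submodule.finrank_eq_zero, ← LinearMap.le_ker_iff_map] at h0
    exact h0
  have heq : LinearMap.range (f ^ 4) = LinearMap.ker B :=
    Submodule.eq_of_le_of_finrank_le hle (by omega)
  have hle2 : LinearMap.ker B ≤ LinearMap.range (f ^ 2) := by
    rw [← heq]
    rintro _ ⟨x, rfl⟩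
    exact ⟨(f ^ 2) x, by rw [← Module.End.mul_apply, ← pow_add]⟩
  -- The radical is a line inside the range of `f ^ 2`, so `B ∘ₗ f ^ 2` has the odd rank 3.
  have hrk := LinearMap.finrank_range_add_finrank_ker (B.domRestrict (LinearMap.range (f ^ 2)))
  rw [LinearMap.range_domRestrict, LinearMap.ker_domRestrict,
    (Submodule.comapSubtypeEquivOfLe hle2).finrank_eq, ← heq, h2, h4] at hrk
  obtain ⟨c, hc⟩ := e2
  omega

/-- If `f ^ 3` and `f ^ 4` have ranks `2` and `1`, then `f` does not leave invariant a hyperplane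
on which it commutes with a complex structure. -/
theorem not_commute_of_finrank_range {V : Type*} [AddCommGroup V] [Module ℝ V]
    [Module.Finite ℝ V] (hV : Module.finrank ℝ V = 9) {f : V →ₗ[ℝ] V}
    (h3 : Module.finrank ℝ (LinearMap.range (f ^ 3)) = 2)
    (h4 : Module.finrank ℝ (LinearMap.range (f ^ 4)) = 1) (φ : V →ₗ[ℝ] ℝ) (J : V →ₗ[ℝ] V)
    (hJφ : ∀ v, φ v = 0 → φ (J v) = 0) (hJ : ∀ v, φ v = 0 → J (J v) = -v)
    (hfφ : ∀ v, φ v = 0 → φ (f v) = 0) : ¬ ∀ v, φ v = 0 → f (J v) = J (f v) := by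
  intro hcomm
  have hpow : ∀ n v, φ v = 0 → φ ((f ^ n) v) = 0 ∧ (f ^ n) (J v) = J ((f ^ n) v) := by
    intro n
    induction n with
    | zero => simp +contextual
    | succ n ih =>
      intro v hv
      rw [pow_succ', Module.End.mul_apply, Module.End.mul_apply, (ih v hv).2]
      exact ⟨hfφ _ (ih v hv).1, hcomm _ (ih v hv).1⟩
  have heven : ∀ n, Even (Module.finrank ℝ (Submodule.map (f ^ n) (LinearMap.ker φ))) := by
    intro n
    apply even_finrank_of_apply_apply_eq_neg J
    · rintro _ ⟨v, hv, rfl⟩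
      exact ⟨J v, hJφ v hv, (hpow n v hv).2⟩
    · rintro _ ⟨v, hv, rfl⟩
      exact hJ _ (hpow n v hv).1
  have hker : 8 ≤ Module.finrank ℝ (LinearMap.ker φ) := by
    have := LinearMap.finrank_range_add_finrank_ker φ
    have := Submodule.finrank_le (LinearMap.range φ)
    rw [Module.finrank_self] at this
    omega
  have hle : Submodule.map (f ^ 3) (LinearMap.ker φ) ≤ LinearMap.range (f ^ 3) :=
    LinearMap.map_le_range
  -- A proper even-dimensional subspace of a plane is zero; but `f ^ 3` has a kernel of dimension 7
  -- and cannot kill `ker φ`, of dimension at least 8.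
  have heq : Submodule.map (f ^ 3) (LinearMap.ker φ) = LinearMap.range (f ^ 3) := by
    apply Submodule.eq_of_le_of_finrank_le hle
    by_contra hlt
    obtain ⟨c, hc⟩ := heven 3
    have h0 : Module.finrank ℝ (Submodule.map (f ^ 3) (LinearMap.ker φ)) = 0 := by omega
    rw [Submodule.finrank_eq_zero, ← LinearMap.le_ker_iff_map] at h0
    have := Submodule.finrank_mono h0
    have := LinearMap.finrank_range_add_finrank_ker (f ^ 3)
    omega
  have h := heven 4
  rw [pow_succ', Module.End.mul_eq_comp, Submodule.map_comp, heq, ← LinearMap.range_comp,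
    ← Module.End.mul_eq_comp, ← pow_succ', h4] at h
  exact absurd h (by decide)

/-! ### Nilpotency and the two nonexistence statements for `g_A`. -/

namespace AlmostAbelianAlg

variable {d : ℕ} (A : Matrix (Fin d) (Fin d) ℝ)

/-- The identification of `g_A` with `ℝ × ℝ ^ d` as vector spaces. -/
noncomputable def toProd : AlmostAbelianAlg A ≃ₗ[ℝ] ℝ × (Fin d → ℝ) :=
  LinearEquiv.refl ℝ (ℝ × (Fin d → ℝ))

@[simp] theorem toProd_symm_apply_fst (x : ℝ × (Fin d → ℝ)) : ((toProd A).symm x).1 = x.1 := rfl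

@[simp] theorem toProd_symm_apply_snd (x : ℝ × (Fin d → ℝ)) : ((toProd A).symm x).2 = x.2 := rfl

@[simp] theorem fst_zero : (0 : AlmostAbelianAlg A).1 = 0 := rfl

@[simp] theorem snd_zero : (0 : AlmostAbelianAlg A).2 = 0 := rfl

variable {A} in
@[ext] theorem ext {x y : AlmostAbelianAlg A} (h1 : x.1 = y.1) (h2 : x.2 = y.2) : x = y :=
  Prod.ext h1 h2

instance : Module.Finite ℝ (AlmostAbelianAlg A) := Module.Finite.equiv (toProd A).symm

theorem finrank_eq : Module.finrank ℝ (AlmostAbelianAlg A) = d + 1 := by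
  rw [(toProd A).finrank_eq]
  simp [add_comm]

theorem isAlmostAbelian : IsAlmostAbelian (AlmostAbelianAlg A) := by
  let p : AlmostAbelianAlg A →ₗ[ℝ] ℝ := LinearMap.fst ℝ ℝ (Fin d → ℝ) ∘ₗ (toProd A).toLinearMap
  let h : LieIdeal ℝ (AlmostAbelianAlg A) :=
    { LinearMap.ker p with lie_mem := fun {_ _} _ => rfl }
  refine ⟨h, ⟨?_⟩, ?_⟩
  · rintro ⟨x, hx⟩ ⟨y, hy⟩
    have hx' : x.1 = 0 := hx
    have hy' : y.1 = 0 := hy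
    apply Subtype.ext
    change ⁅x, y⁆ = 0
    refine AlmostAbelianAlg.ext rfl ?_
    rw [snd_lie, hx', hy']
    simp only [zero_smul, sub_zero]
    rfl
  · have hp : Function.Surjective p := fun s => ⟨(toProd A).symm (s, 0), rfl⟩
    have := (p.quotKerEquivOfSurjective hp).finrank_eq
    rw [Module.finrank_self] at this
    exact this

variable {A}

/-- One bracket lands in the abelian ideal, where `x` acts as `x.1 • A`. With Engel's theorem,
nilpotency of `A` then gives that of `g_A`. -/
theorem ad_pow_succ_apply (x y : AlmostAbelianAlg A) (n : ℕ) :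
    ((LieAlgebra.ad ℝ (AlmostAbelianAlg A) x) ^ (n + 1)) y =
      (toProd A).symm (0, x.1 ^ n • (A.mulVecLin ^ n) ⁅x, y⁆.2) := by
  induction n with
  | zero => simp; rfl
  | succ n ih =>
    rw [pow_succ', Module.End.mul_apply, ih, LieAlgebra.ad_apply]
    refine AlmostAbelianAlg.ext rfl ?_
    rw [snd_lie]
    simp only [toProd_symm_apply_snd, toProd_symm_apply_fst, zero_smul, sub_zero,
      Matrix.mulVec_smul, smul_smul, pow_succ', Module.End.mul_apply, Matrix.mulVecLin_apply]

theorem isNilpotent (hA : IsNilpotent A.mulVecLin) : LieRing.IsNilpotent (AlmostAbelianAlg A) := by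
  obtain ⟨n, hn⟩ := hA
  rw [LieAlgebra.isNilpotent_iff_forall (R := ℝ)]
  refine fun x => ⟨n + 1, LinearMap.ext fun y => ?_⟩
  rw [ad_pow_succ_apply, hn]
  simp

theorem not_admitsComplexStructure {A : Matrix (Fin 9) (Fin 9) ℝ}
    (h3 : Module.finrank ℝ (LinearMap.range (A.mulVecLin ^ 3)) = 2)
    (h4 : Module.finrank ℝ (LinearMap.range (A.mulVecLin ^ 4)) = 1) :
    ¬ AdmitsComplexStructure (AlmostAbelianAlg A) := by
  rintro ⟨j, hj, hN⟩
  let inc : (Fin 9 → ℝ) →ₗ[ℝ] AlmostAbelianAlg A :=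
    (toProd A).symm.toLinearMap ∘ₗ LinearMap.inr ℝ ℝ (Fin 9 → ℝ)
  let φ : (Fin 9 → ℝ) →ₗ[ℝ] ℝ :=
    LinearMap.fst ℝ ℝ (Fin 9 → ℝ) ∘ₗ (toProd A).toLinearMap ∘ₗ j ∘ₗ inc
  let J : (Fin 9 → ℝ) →ₗ[ℝ] (Fin 9 → ℝ) :=
    LinearMap.snd ℝ ℝ (Fin 9 → ℝ) ∘ₗ (toProd A).toLinearMap ∘ₗ j ∘ₗ inc
  have hφJ : ∀ v, j (inc v) = (toProd A).symm (φ v, J v) := fun v => rfl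
  have hinc : ∀ v, inc v = (toProd A).symm (0, v) := fun v => rfl
  have hφJ0 : ∀ v, φ v = 0 → j (inc v) = inc (J v) := fun v hv => by rw [hφJ, hv, hinc]
  have hJJ : ∀ v, φ v = 0 → φ (J v) = 0 ∧ J (J v) = -v := by
    intro v hv
    have h := hj (inc v)
    rw [hφJ0 v hv, hφJ, ← map_neg, hinc] at h
    have h' := (toProd A).symm.injective h
    simpa using h'
  -- Otherwise `J` would be a complex structure on the odd-dimensional space `ℝ ^ 9`.
  obtain ⟨e, he⟩ : ∃ e, φ e ≠ 0 := by
    by_contra! hall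
    have := even_finrank_of_apply_apply_eq_neg J ⊤ (fun _ _ => trivial)
      (fun v _ => (hJJ v (hall v)).2)
    rw [finrank_top, Module.finrank_fin_fun] at this
    exact absurd this (by decide)
  have hcomm : ∀ v, φ v = 0 → φ (A.mulVecLin v) = 0 ∧ A.mulVecLin (J v) = J (A.mulVecLin v) := by
    intro v hv
    -- Since `v` and `j v` both lie in the abelian ideal, only the brackets with `j e` survive. They
    -- carry the common factor `φ e`, leaving `j (A v) = A (J v)`, whose two components are the
    -- claims.
    have h := hN (inc e) (inc v)
    have h0 : ∀ u w, ⁅inc u, inc w⁆ = 0 := fun u w =>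
      AlmostAbelianAlg.ext rfl (by rw [snd_lie]; simp [hinc])
    have h1 : ∀ w, ⁅j (inc e), inc w⁆ = φ e • inc (A.mulVecLin w) := fun w =>
      AlmostAbelianAlg.ext (by simp [hinc]) (by rw [snd_lie, hφJ]; simp [hinc])
    rw [hφJ0 v hv, h0, h0, h1, h1, zero_add, add_zero, map_smul, ← smul_sub] at h
    have h2 := sub_eq_zero.1 ((smul_eq_zero.1 h).resolve_left he)
    rw [hφJ, hinc] at h2
    have h3 := (toProd A).symm.injective h2
    rw [Prod.mk.injEq] at h3
    exact ⟨h3.1, h3.2.symm⟩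
  exact not_commute_of_finrank_range (by simp) h3 h4 φ J (fun v hv => (hJJ v hv).1)
    (fun v hv => (hJJ v hv).2) (fun v hv => (hcomm v hv).1) (fun v hv => (hcomm v hv).2)

theorem not_admitsSymplecticStructure
    (h2 : Module.finrank ℝ (LinearMap.range (A.mulVecLin ^ 2)) = 4)
    (h4 : Module.finrank ℝ (LinearMap.range (A.mulVecLin ^ 4)) = 1) :
    ¬ AdmitsSymplecticStructure (AlmostAbelianAlg A) := by
  rintro ⟨ω, halt, hnd, hclosed⟩
  let inc : (Fin d → ℝ) →ₗ[ℝ] AlmostAbelianAlg A :=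
    (toProd A).symm.toLinearMap ∘ₗ LinearMap.inr ℝ ℝ (Fin d → ℝ)
  let e₀ : AlmostAbelianAlg A := (toProd A).symm (1, 0)
  have hinc : ∀ v, inc v = (toProd A).symm (0, v) := fun v => rfl
  have hinj : Function.Injective inc :=
    (toProd A).symm.injective.comp LinearMap.inr_injective
  have hdec : ∀ x : AlmostAbelianAlg A, x = x.1 • e₀ + inc x.2 := fun x =>
    AlmostAbelianAlg.ext (by simp [e₀, hinc]) (by simp [e₀, hinc])
  let B : LinearMap.BilinForm ℝ (Fin d → ℝ) := ω.compl₁₂ inc inc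
  refine not_skew_of_finrank_range (B := B) (fun v => halt (inc v)) ?_ h2 h4 ?_
  -- A vector of the radical of `B` that is also orthogonal to `e₀` lies in the radical of `ω`;
  -- hence one linear form is injective on the radical of `B`.
  · have hψ : LinearMap.ker B ⊓ LinearMap.ker (ω e₀ ∘ₗ inc) = ⊥ := by
      rw [eq_bot_iff]
      rintro v ⟨hv1, hv2⟩
      have hv1' : ∀ w, ω (inc v) (inc w) = 0 := fun w => LinearMap.congr_fun hv1 w
      have hv2' : ω (inc v) e₀ = 0 := by rw [← halt.neg_eq, neg_eq_zero]; exact hv2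
      refine hinj ((hnd.1 (inc v) fun y => ?_).trans (map_zero inc).symm)
      rw [hdec y]
      simp [hv1', hv2']
    have h1 := Submodule.finrank_sup_add_finrank_inf_eq (LinearMap.ker B)
      (LinearMap.ker (ω e₀ ∘ₗ inc))
    rw [hψ, finrank_bot] at h1
    have h3 := LinearMap.finrank_range_add_finrank_ker (ω e₀ ∘ₗ inc)
    have h5 := Submodule.finrank_le (LinearMap.range (ω e₀ ∘ₗ inc))
    rw [Module.finrank_self] at h5
    have h6 := Submodule.finrank_le (LinearMap.ker B ⊔ LinearMap.ker (ω e₀ ∘ₗ inc))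
    omega
  · intro v w
    have h := hclosed e₀ (inc v) (inc w)
    have h1 : ⁅e₀, inc v⁆ = inc (A.mulVecLin v) :=
      AlmostAbelianAlg.ext rfl (by rw [snd_lie]; simp [e₀, hinc])
    have h3 : ⁅inc v, inc w⁆ = 0 :=
      AlmostAbelianAlg.ext rfl (by rw [snd_lie]; simp [hinc])
    have h5 : ⁅inc w, e₀⁆ = -inc (A.mulVecLin w) :=
      AlmostAbelianAlg.ext (by simp [← map_neg, hinc])
        (by rw [snd_lie, ← map_neg]; simp [e₀, hinc])
    rw [h1, h3, h5, map_zero, map_neg, LinearMap.zero_apply, LinearMap.neg_apply, ← halt.neg_eq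
      (inc v)] at h
    change ω (inc (A.mulVecLin v)) (inc w) + ω (inc v) (inc (A.mulVecLin w)) = 0
    linarith

/-- A linear map conjugating `A` to `M` induces an isomorphism `g_A ≃ g_M`. -/
theorem nonempty_lieEquiv {A M : Matrix (Fin d) (Fin d) ℝ} (φ : (Fin d → ℝ) ≃ₗ[ℝ] (Fin d → ℝ))
    (hφ : ∀ v, φ (A.mulVecLin v) = M.mulVecLin (φ v)) :
    Nonempty (AlmostAbelianAlg A ≃ₗ⁅ℝ⁆ AlmostAbelianAlg M) := by
  let ψ : AlmostAbelianAlg A ≃ₗ[ℝ] AlmostAbelianAlg M :=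
    toProd A ≪≫ₗ (LinearEquiv.refl ℝ ℝ).prodCongr φ ≪≫ₗ (toProd M).symm
  have h1 : ∀ x, (ψ x).1 = x.1 := fun x => rfl
  have h2 : ∀ x, (ψ x).2 = φ x.2 := fun x => rfl
  refine ⟨{ ψ with map_lie' := fun {x y} => ?_ }⟩
  change ψ ⁅x, y⁆ = ⁅ψ x, ψ y⁆
  simp only [Matrix.mulVecLin_apply] at hφ
  exact AlmostAbelianAlg.ext rfl (by rw [snd_lie, h2, snd_lie, h1, h1, h2, h2]; simp [hφ])

end AlmostAbelianAlg

theorem AdmitsSymplecticStructure.of_lieEquiv {g g' : Type*} [LieRing g] [LieAlgebra ℝ g]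
    [LieRing g'] [LieAlgebra ℝ g'] (e : g ≃ₗ⁅ℝ⁆ g') (h : AdmitsSymplecticStructure g') :
    AdmitsSymplecticStructure g := by
  obtain ⟨ω, halt, hnd, hclosed⟩ := h
  let e' : g ≃ₗ[ℝ] g' := e.toLinearEquiv
  refine ⟨LinearMap.BilinForm.congr e'.symm ω, fun x => halt (e x), hnd.congr e'.symm,
    fun x y z => ?_⟩
  have := hclosed (e x) (e y) (e z)
  rw [← LieEquiv.map_lie, ← LieEquiv.map_lie, ← LieEquiv.map_lie] at this
  exact this

/-! ### The normal form of nilpotent almost abelian Lie algebras. -/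

/-- A nilpotent almost abelian Lie algebra of dimension `d + 1` is `g_A` for a nilpotent `A`. -/
theorem exists_lieEquiv_almostAbelianAlg {g : Type*} [LieRing g] [LieAlgebra ℝ g] {d : ℕ}
    (hdim : Module.finrank ℝ g = d + 1) (hnil : LieRing.IsNilpotent g) (hg : IsAlmostAbelian g) :
    ∃ A : Matrix (Fin d) (Fin d) ℝ,
      IsNilpotent A.mulVecLin ∧ Nonempty (g ≃ₗ⁅ℝ⁆ AlmostAbelianAlg A) := by
  obtain ⟨h, hab, hq⟩ := hg
  have hfin : Module.Finite ℝ g := Module.finite_of_finrank_pos (by omega)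
  have hh : Module.finrank ℝ h = d := by
    have := Submodule.finrank_quotient_add_finrank (h : Submodule ℝ g)
    have hq' : Module.finrank ℝ (g ⧸ (h : Submodule ℝ g)) = 1 := hq
    have hh' : Module.finrank ℝ (h : Submodule ℝ g) = Module.finrank ℝ h := rfl
    omega
  obtain ⟨e₀, he₀⟩ : ∃ e₀ : g, e₀ ∉ h := by
    by_contra! hall
    have : h = ⊤ := by ext x; simp [hall x]
    subst this
    have := (LinearEquiv.ofTop (⊤ : Submodule ℝ g) rfl).finrank_eq
    have h2 : Module.finrank ℝ (⊤ : LieIdeal ℝ g) = Module.finrank ℝ (⊤ : Submodule ℝ g) := rfl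
    omega
  let f : h →ₗ[ℝ] h := LieModule.toEnd ℝ g h e₀
  have hf : ∀ v, (f v : g) = ⁅e₀, (v : g)⁆ := fun v => rfl
  let c : Module.Basis (Fin d) ℝ h := Module.finBasisOfFinrankEq ℝ h hh
  let A := LinearMap.toMatrix c c f
  have hA : ∀ v, A.mulVecLin (c.equivFun v) = c.equivFun (f v) := fun v => by
    rw [Matrix.mulVecLin_apply]
    exact LinearMap.toMatrix_mulVec_repr c c f v
  have hA' : ∀ w, (c.equivFun.symm (A.mulVecLin w) : g) =
      ⁅e₀, (c.equivFun.symm w : g)⁆ := fun w => by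
    obtain ⟨v, rfl⟩ := c.equivFun.surjective w
    rw [hA, LinearEquiv.symm_apply_apply, LinearEquiv.symm_apply_apply, hf]
  refine ⟨A, ?_, ?_⟩
  · obtain ⟨n, hn⟩ := (LieAlgebra.isNilpotent_iff_forall (R := ℝ)).1 hnil e₀
    refine ⟨n, LinearMap.ext fun w => ?_⟩
    apply c.equivFun.symm.injective
    apply Subtype.ext
    -- In coordinates `A` is the restriction of `ad e₀` to the ideal, and `ad e₀` is nilpotent.
    have hp : ∀ m, (c.equivFun.symm ((A.mulVecLin ^ m) w) : g) =
        ((LieAlgebra.ad ℝ g e₀) ^ m) (c.equivFun.symm w : g) := by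
      intro m
      induction m with
      | zero => rfl
      | succ m ih =>
        rw [pow_succ', pow_succ', Module.End.mul_apply, Module.End.mul_apply, hA', ih]
        rfl
    rw [hp, hn]
    simp
  · let ψ : AlmostAbelianAlg A →ₗ[ℝ] g :=
      (LinearMap.coprod (LinearMap.toSpanSingleton ℝ g e₀)
        ((h : Submodule ℝ g).subtype ∘ₗ c.equivFun.symm.toLinearMap)) ∘ₗ
        (AlmostAbelianAlg.toProd A).toLinearMap
    have hψ : ∀ x, ψ x = x.1 • e₀ + (c.equivFun.symm x.2 : g) := fun x => rfl
    have hinj : Function.Injective ψ := by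
      rw [← LinearMap.ker_eq_bot, LinearMap.ker_eq_bot']
      intro x hx
      rw [hψ] at hx
      have h1 : x.1 = 0 := by
        by_contra hne
        apply he₀
        have : e₀ = x.1⁻¹ • (-(c.equivFun.symm x.2 : g)) := by
          rw [eq_inv_smul_iff₀ hne, eq_neg_iff_add_eq_zero]
          exact hx
        rw [this]
        exact h.smul_mem _ (h.neg_mem (c.equivFun.symm x.2).2)
      rw [h1, zero_smul, zero_add] at hx
      refine AlmostAbelianAlg.ext h1 ?_
      exact c.equivFun.symm.injective ((Subtype.ext hx).trans (map_zero c.equivFun.symm).symm)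
    have hbij : Function.Bijective ψ := by
      refine ⟨hinj, (LinearMap.injective_iff_surjective_of_finrank_eq_finrank ?_).1 hinj⟩
      rw [AlmostAbelianAlg.finrank_eq, hdim]
    let ψ' : AlmostAbelianAlg A →ₗ⁅ℝ⁆ g :=
      { ψ with
        map_lie' := fun {x y} => by
          change ψ ⁅x, y⁆ = ⁅ψ x, ψ y⁆
          have hab' : ∀ u v : h, ⁅(u : g), (v : g)⁆ = 0 := fun u v =>
            congrArg Subtype.val (hab.trivial u v)
          have hsub : ∀ (s t : ℝ) (u v : Fin d → ℝ), (c.equivFun.symm (s • u - t • v) : g) =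
              s • (c.equivFun.symm u : g) - t • (c.equivFun.symm v : g) := fun s t u v => by
            rw [map_sub, map_smul, map_smul]
            rfl
          rw [hψ, hψ, hψ]
          simp only [lie_add, add_lie, smul_lie, lie_smul, lie_self, smul_zero, hab', zero_add,
            add_zero, AlmostAbelianAlg.fst_lie, zero_smul, AlmostAbelianAlg.snd_lie, hsub,
            ← Matrix.mulVecLin_apply, hA']
          rw [← lie_skew (c.equivFun.symm x.2 : g) e₀, smul_neg, sub_eq_add_neg, add_comm (_ • _)] }
    exact ⟨(LieEquiv.ofBijective ψ' hbij).symm⟩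

/-! ### Symplectic structures from pairings of Jordan chains. -/

/-- A skew-invariant alternating form `β` on `ℝ ^ d` and a linear form `α` which is an isomorphism
on the radical of `β` combine to a symplectic structure `e⁰ ∧ α + β` on `g_A`. -/
theorem AlmostAbelianAlg.admitsSymplecticStructure {d : ℕ} {A : Matrix (Fin d) (Fin d) ℝ}
    {β : LinearMap.BilinForm ℝ (Fin d → ℝ)} (hβ : β.IsAlt)
    (hA : ∀ v w, β (A.mulVecLin v) w + β v (A.mulVecLin w) = 0) (α : (Fin d → ℝ) →ₗ[ℝ] ℝ)
    {u : Fin d → ℝ} (hu : α u ≠ 0) (huβ : ∀ v, β v u = 0)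
    (hnd : ∀ v, α v = 0 → (∀ w, β v w = 0) → v = 0) :
    AdmitsSymplecticStructure (AlmostAbelianAlg A) := by
  let p : AlmostAbelianAlg A →ₗ[ℝ] ℝ := LinearMap.fst ℝ ℝ (Fin d → ℝ) ∘ₗ (toProd A).toLinearMap
  let q : AlmostAbelianAlg A →ₗ[ℝ] (Fin d → ℝ) :=
    LinearMap.snd ℝ ℝ (Fin d → ℝ) ∘ₗ (toProd A).toLinearMap
  let ω₀ : LinearMap.BilinForm ℝ (AlmostAbelianAlg A) := (LinearMap.mul ℝ ℝ).compl₁₂ p (α ∘ₗ q)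
  let ω : LinearMap.BilinForm ℝ (AlmostAbelianAlg A) := ω₀ - ω₀.flip + β.compl₁₂ q q
  have hω : ∀ x y, ω x y = x.1 * α y.2 - y.1 * α x.2 + β x.2 y.2 := fun x y => rfl
  have halt : ω.IsAlt := fun x => by rw [hω, hβ]; ring
  refine ⟨ω, halt, ?_, fun x y z => ?_⟩
  · refine halt.isRefl.nondegenerate_iff_separatingLeft.2 fun x hx => ?_
    have h1 : x.1 = 0 := by
      have := hx ((toProd A).symm (0, u))
      rw [hω] at this
      simpa [huβ, hu] using this
    have h2 : α x.2 = 0 := by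
      have := hx ((toProd A).symm (1, 0))
      rw [hω] at this
      simpa using this
    refine AlmostAbelianAlg.ext h1 (hnd _ h2 fun w => ?_)
    have := hx ((toProd A).symm (0, w))
    rw [hω] at this
    simpa [h1] using this
  · have hA' : ∀ v w, β (A.mulVecLin v) w = β (A.mulVecLin w) v := fun v w => by
      rw [← hβ.neg_eq v]
      linarith [hA v w]
    simp only [hω, fst_lie, snd_lie, map_sub, map_smul, LinearMap.sub_apply, LinearMap.smul_apply,
      smul_eq_mul, ← Matrix.mulVecLin_apply]
    rw [hA' y.2 z.2, hA' x.2 z.2, hA' x.2 y.2]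
    ring

namespace IsJordanBasis

variable {ι V : Type*} [LinearOrder ι] [AddCommGroup V] [Module ℝ V] {k : ι → ℕ}

/-- The coefficients of an alternating form on a space with a Jordan basis: the chain `i` is paired
with the chain `τ i`, and the vectors at the positions `j` and `j'` of the two chains are paired
when `j + j' + 1 = l i`. -/
noncomputable def pairing (τ : ι → ι) (l : ι → ℕ) (i : ι) (j : ℕ) (i' : ι) (j' : ℕ) : ℝ :=
  if i' = τ i ∧ j + j' + 1 = l i then (if τ i < i ∧ Odd (l i) then -1 else 1) * (-1) ^ j else 0

theorem pairing_of_pos {τ : ι → ι} {l : ι → ℕ} {i i' : ι} {j j' : ℕ} (hi : i' = τ i)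
    (hj : j + j' + 1 = l i) :
    pairing τ l i j i' j' = (if τ i < i ∧ Odd (l i) then -1 else 1) * (-1) ^ j :=
  if_pos ⟨hi, hj⟩

theorem pairing_of_neg {τ : ι → ι} {l : ι → ℕ} {i i' : ι} {j j' : ℕ}
    (h : ¬ (i' = τ i ∧ j + j' + 1 = l i)) : pairing τ l i j i' j' = 0 :=
  if_neg h

/-- Paired positions satisfy `j + j' = l i - 1`. For even `l i` the signs `(-1) ^ j` and `(-1) ^ j'`
are opposite, so a chain may be paired with itself. For odd `l i` they agree, and the sign comes
from the order of `i` and `τ i`, which must then differ. -/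
theorem pairing_skew {τ : ι → ι} {l : ι → ℕ} (hτ : Function.Involutive τ)
    (hl : ∀ i, l (τ i) = l i) (hfix : ∀ i, τ i = i → Even (l i)) (i : ι) (j : ℕ) (i' : ι) (j' : ℕ) :
    pairing τ l i j i' j' = -pairing τ l i' j' i j := by
  by_cases h : i' = τ i ∧ j + j' + 1 = l i
  · obtain ⟨rfl, h⟩ := h
    rw [pairing_of_pos rfl h, pairing_of_pos (hτ i).symm (by rw [hl]; omega), hτ, hl]
    rcases Nat.even_or_odd (l i) with he | ho
    · have hno : ¬ Odd (l i) := by simpa using he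
      simp only [hno, and_false, if_false, one_mul]
      have hodd : Odd (j + j') := by
        rw [← h, Nat.even_add_one, Nat.not_even_iff_odd] at he
        exact he
      rcases Nat.even_or_odd j with hj | hj
      · have hj' : Odd j' := by rwa [Nat.odd_add', iff_true_right hj] at hodd
        simp [hj.neg_one_pow, hj'.neg_one_pow]
      · have hj' : Even j' := by rwa [Nat.odd_add, iff_true_left hj] at hodd
        simp [hj.neg_one_pow, hj'.neg_one_pow]
    · have hne : τ i ≠ i := fun h0 => by
        have := hfix i h0
        rw [← Nat.not_odd_iff_even] at this
        exact this ho
      have hpow : (-1 : ℝ) ^ j = (-1) ^ j' := by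
        have heven : Even (j + j') := by
          rw [← h, Nat.odd_add_one, Nat.not_odd_iff_even] at ho
          exact ho
        rcases Nat.even_or_odd j with hj | hj
        · rw [hj.neg_one_pow, ((Nat.even_add.1 heven).1 hj).neg_one_pow]
        · rw [hj.neg_one_pow, Odd.neg_one_pow]
          rw [← Nat.not_even_iff_odd] at hj ⊢
          exact fun h' => hj ((Nat.even_add.1 heven).2 h')
      rw [hpow]
      rcases lt_or_gt_of_ne hne with h' | h'
      · simp [h', ho, h'.not_gt]
      · simp [h', ho, h'.not_gt]
  · rw [pairing_of_neg h, pairing_of_neg, neg_zero]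
    rintro ⟨rfl, h'⟩
    exact h ⟨(hτ i').symm, by rw [hl]; omega⟩

/-- Both terms have the same support and the sign alternates with `j`. This makes the nilpotent map
skew for the form. -/
theorem pairing_succ (τ : ι → ι) (l : ι → ℕ) (i : ι) (j : ℕ) (i' : ι) (j' : ℕ) :
    pairing τ l i (j + 1) i' j' + pairing τ l i j i' (j' + 1) = 0 := by
  by_cases h : i' = τ i ∧ j + 1 + j' + 1 = l i
  · rw [pairing_of_pos h.1 h.2, pairing_of_pos h.1 (by omega)]
    ring
  · rw [pairing_of_neg h, pairing_of_neg (fun h' => h ⟨h'.1, by omega⟩), add_zero]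

/-- If the chains of odd length of a Jordan basis of `A` can be paired off except for one of them,
then `g_A` is symplectic. -/
theorem admitsSymplecticStructure [Fintype ι] {d : ℕ} {A : Matrix (Fin d) (Fin d) ℝ}
    {b : Module.Basis ((i : ι) × Fin (k i)) ℝ (Fin d → ℝ)} (hb : IsJordanBasis A.mulVecLin b)
    {τ : ι → ι} (hτ : Function.Involutive τ) (hk : ∀ i, k (τ i) = k i) (i₀ : ι) (hi₀ : τ i₀ = i₀)
    (hodd : Odd (k i₀)) (hfix : ∀ i, i ≠ i₀ → τ i = i → Even (k i)) :
    AdmitsSymplecticStructure (AlmostAbelianAlg A) := by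
  -- Dropping the last vector of the unpaired odd chain leaves an even length, so this chain can be
  -- paired with itself. The dropped vector spans the radical of `β`, and its coordinate serves as
  -- `α`.
  let l : ι → ℕ := fun i => if i = i₀ then k i - 1 else k i
  have hl₀ : l i₀ + 1 = k i₀ := by
    have := hodd.pos
    simp only [l, if_true]
    omega
  have hl : ∀ i, i ≠ i₀ → l i = k i := fun i hi => if_neg hi
  have hlk : ∀ i, l i ≤ k i := fun i => by
    dsimp only [l]
    split_ifs <;> omega
  have hlτ : ∀ i, l (τ i) = l i := fun i => by
    by_cases hi : i = i₀
    · rw [hi, hi₀]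
    · rw [hl i hi, hl, hk]
      intro h
      exact hi (by rw [← hτ i, h, hi₀])
  have hlfix : ∀ i, τ i = i → Even (l i) := fun i h => by
    by_cases hi : i = i₀
    · rw [← hl₀, Nat.odd_add_one, Nat.not_odd_iff_even] at hodd
      rwa [hi]
    · rw [hl i hi]
      exact hfix i hi h
  let β : LinearMap.BilinForm ℝ (Fin d → ℝ) :=
    b.constr ℝ fun p => b.constr ℝ fun q => pairing τ l p.1 p.2 q.1 q.2
  have hβ : ∀ p q, β (b p) (b q) = pairing τ l p.1 p.2 q.1 q.2 := fun p q => by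
    simp [β]
  have hskew : β + β.flip = 0 := b.ext fun p => b.ext fun q => by
    change β (b p) (b q) + β (b q) (b p) = 0
    rw [hβ, hβ, pairing_skew hτ hlτ hlfix, neg_add_cancel]
  have halt : β.IsAlt := fun v => by
    have : β v v + β v v = 0 := LinearMap.congr_fun (LinearMap.congr_fun hskew v) v
    linarith
  have hinv : β.compl₁₂ A.mulVecLin LinearMap.id + β.compl₁₂ LinearMap.id A.mulVecLin = 0 :=
    b.ext fun ⟨i, j⟩ => b.ext fun ⟨i', j'⟩ => by
      simp only [LinearMap.add_apply, LinearMap.compl₁₂_apply, LinearMap.id_apply,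
        LinearMap.zero_apply]
      have h1 : β (A.mulVecLin (b ⟨i, j⟩)) (b ⟨i', j'⟩) = pairing τ l i (j + 1) i' j' := by
        rw [hb i j]
        split_ifs with h
        · rw [hβ]
        -- The coefficients vanish beyond the end of a chain, matching the value zero of `A` on its
        -- last vector.
        · rw [map_zero, LinearMap.zero_apply, pairing_of_neg]
          rintro ⟨-, h'⟩
          have := hlk i
          omega
      have h2 : β (b ⟨i, j⟩) (A.mulVecLin (b ⟨i', j'⟩)) = pairing τ l i j i' (j' + 1) := by
        rw [hb i' j']
        split_ifs with h
        · rw [hβ]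
        · rw [map_zero, pairing_of_neg]
          rintro ⟨rfl, h'⟩
          have := hlk (τ i)
          rw [hlτ] at this
          omega
      rw [h1, h2, pairing_succ]
  let last : (i : ι) × Fin (k i) := ⟨i₀, ⟨l i₀, by omega⟩⟩
  refine AlmostAbelianAlg.admitsSymplecticStructure halt
    (fun v w => LinearMap.congr_fun (LinearMap.congr_fun hinv v) w) (b.coord last) (u := b last)
    (by simp) ?_ ?_
  · suffices h : β.flip (b last) = 0 from fun v => LinearMap.congr_fun h v
    refine b.ext fun p => ?_
    change β (b p) (b last) = 0
    rw [hβ, pairing_of_neg]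
    rintro ⟨h1, h2⟩
    have : l p.1 = l i₀ := congrArg l (by rw [← hτ p.1, ← h1, hi₀])
    simp only [last] at h2
    omega
  · intro v hv0 hv
    refine b.ext_elem fun ⟨i, j⟩ => ?_
    rw [map_zero, Finsupp.zero_apply]
    by_cases hlt : (j : ℕ) < l i
    · have hτk : l i - 1 - j < k (τ i) := by
        have := hlk i
        rw [hk]
        omega
      -- This basis vector pairs nontrivially with `b ⟨i, j⟩` only, so it isolates that coefficient
      -- of `v` up to sign.
      have h := hv (b ⟨τ i, ⟨l i - 1 - j, hτk⟩⟩)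
      rw [← b.sum_repr v, map_sum, LinearMap.sum_apply, Finset.sum_eq_single ⟨i, j⟩] at h
      · rw [map_smul, LinearMap.smul_apply, hβ, pairing_of_pos rfl (by dsimp only; omega),
          smul_eq_mul] at h
        refine (mul_eq_zero.1 h).resolve_right (mul_ne_zero ?_ (pow_ne_zero _ (by norm_num)))
        split_ifs <;> norm_num
      · rintro ⟨i', j'⟩ - hne
        rw [map_smul, LinearMap.smul_apply, hβ, pairing_of_neg, smul_zero]
        rintro ⟨h1, h2⟩
        dsimp only at h1 h2
        obtain rfl : i = i' := hτ.injective h1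
        apply hne
        congr 1
        exact Fin.ext (by omega)
      · simp
    · obtain rfl : i = i₀ := by
        by_contra hi
        rw [hl i hi] at hlt
        exact hlt j.2
      have : j = ⟨l i, by omega⟩ := Fin.ext (by have := j.2; dsimp only; omega)
      rw [this]
      exact hv0

end IsJordanBasis

/-! ### Combinatorics of the block sizes. -/

/-- The elements of a finite type on which `k` takes equal odd values can be paired off, with at
most one left over for each odd value. -/
theorem exists_involutive_comp_eq {ι : Type*} [Finite ι] (k : ι → ℕ) :
    ∃ τ : ι → ι, Function.Involutive τ ∧ (∀ i, k (τ i) = k i) ∧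
      Set.InjOn k {i | τ i = i ∧ Odd (k i)} := by
  classical
  cases nonempty_fintype ι
  suffices h : ∀ S : Finset ι, ∃ τ : ι → ι, Function.Involutive τ ∧ (∀ i, k (τ i) = k i) ∧
      (∀ i, i ∉ S → τ i = i) ∧ Set.InjOn k {i | i ∈ S ∧ τ i = i ∧ Odd (k i)} by
    obtain ⟨τ, h1, h2, -, h3⟩ := h Finset.univ
    exact ⟨τ, h1, h2, by simpa using h3⟩
  intro S
  induction S using Finset.induction_on with
  | empty => exact ⟨id, fun _ => rfl, fun _ => rfl, fun _ _ => rfl, by simp⟩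
  | insert a S ha ih =>
    obtain ⟨τ, hτ, hk, hS, hinj⟩ := ih
    -- If an unpaired `c` has the same odd value as the new element `a`, the two are swapped;
    -- otherwise `a` stays fixed and injectivity persists.
    by_cases hc : ∃ c ∈ S, τ c = c ∧ Odd (k c) ∧ k c = k a
    · obtain ⟨c, hcS, hcτ, hco, hca⟩ := hc
      have hac : a ≠ c := fun h => ha (h ▸ hcS)
      have haτ : τ a = a := hS a ha
      have hτa : ∀ i, τ i = a → i = a := fun i h => by rw [← hτ i, h, haτ]
      have hτc : ∀ i, τ i = c → i = c := fun i h => by rw [← hτ i, h, hcτ]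
      refine ⟨fun i => if i = a then c else if i = c then a else τ i, fun i => ?_, fun i => ?_,
        fun i hi => ?_, ?_⟩
      · dsimp only
        by_cases h1 : i = a
        · simp [h1, hac.symm]
        · by_cases h2 : i = c
          · simp [h2, hac.symm]
          · simp [h1, h2, mt (hτa i) h1, mt (hτc i) h2, hτ i]
      · dsimp only
        split_ifs with h1 h2
        · rw [h1, hca]
        · rw [h2, hca]
        · exact hk i
      · rw [Finset.mem_insert, not_or] at hi
        dsimp only
        rw [if_neg hi.1, if_neg (show ¬i = c from fun h => hi.2 (h ▸ hcS)), hS i hi.2]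
      · have hmem : ∀ i, i ∈ insert a S →
            (if i = a then c else if i = c then a else τ i) = i → i ∈ S ∧ τ i = i := by
          intro i hi h
          split_ifs at h with h1 h2
          · exact absurd (h1 ▸ h).symm hac
          · exact absurd (h2 ▸ h) hac
          · exact ⟨(Finset.mem_insert.1 hi).resolve_left h1, h⟩
        rintro i ⟨hi, hiτ, hio⟩ i' ⟨hi', hiτ', hio'⟩ h
        exact hinj ⟨(hmem i hi hiτ).1, (hmem i hi hiτ).2, hio⟩
          ⟨(hmem i' hi' hiτ').1, (hmem i' hi' hiτ').2, hio'⟩ h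
    · refine ⟨τ, hτ, hk, fun i hi => hS i fun h => hi (Finset.mem_insert_of_mem h), ?_⟩
      push Not at hc
      rintro i ⟨hi, hiτ, hio⟩ i' ⟨hi', hiτ', hio'⟩ h
      rcases Finset.mem_insert.1 hi with rfl | hiS <;>
        rcases Finset.mem_insert.1 hi' with rfl | hiS'
      · rfl
      · exact absurd h.symm (hc i' hiS' hiτ' hio')
      · exact absurd h (hc i hiS hiτ hio)
      · exact hinj ⟨hiS, hiτ, hio⟩ ⟨hiS', hiτ', hio'⟩ h

/-- An odd sum of odd numbers has an odd number of terms, and three distinct odd numbers already sum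
to at least 1 + 3 + 5 = 9. -/
theorem card_eq_one_or_eq_of_sum_le_nine {D : Finset ℕ} (hodd : ∀ n ∈ D, Odd n)
    (hle : ∑ n ∈ D, n ≤ 9) (hsum : Odd (∑ n ∈ D, n)) : D.card = 1 ∨ D = {1, 3, 5} := by
  have hD : D ∈ ({1, 3, 5, 7, 9} : Finset ℕ).powerset := by
    rw [Finset.mem_powerset]
    intro n hn
    have h1 := Finset.single_le_sum (f := fun n : ℕ => n) (fun _ _ => Nat.zero_le _) hn
    have h2 := hodd n hn
    have h3 : n ≤ 9 := h1.trans hle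
    interval_cases n <;> revert h2 <;> decide
  have key : ∀ D ∈ ({1, 3, 5, 7, 9} : Finset ℕ).powerset, ∑ n ∈ D, n ≤ 9 →
      Odd (∑ n ∈ D, n) → D.card = 1 ∨ D = {1, 3, 5} := by decide
  exact key D hD hle hsum

/-- Among finitely many natural numbers with sum `9` the odd ones can be paired off with their
equals except for one of them, or the nonzero ones are `5, 3, 1`. -/
theorem exists_pairing_or_five_three_one {ι : Type*} [Fintype ι] (k : ι → ℕ)
    (hk : ∑ i, k i = 9) :
    (∃ τ : ι → ι, Function.Involutive τ ∧ (∀ i, k (τ i) = k i) ∧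
      ∃ i₀, τ i₀ = i₀ ∧ Odd (k i₀) ∧ ∀ i, i ≠ i₀ → τ i = i → Even (k i)) ∨
    ∃ s : Fin 3 → ι, Function.Injective s ∧ ∀ a, k (s a) = ![5, 3, 1] a := by
  classical
  obtain ⟨τ, hτ, hkτ, hinj⟩ := exists_involutive_comp_eq k
  let F : Finset ι := Finset.univ.filter fun i => τ i = i ∧ Odd (k i)
  have hF : ∀ i, i ∈ F ↔ τ i = i ∧ Odd (k i) := fun i => by simp [F]
  have hinj' : Set.InjOn k F := fun i hi i' hi' => hinj ((hF i).1 hi) ((hF i').1 hi')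
  have hsplit := Finset.sum_add_sum_compl F k
  -- Outside `F`, the elements moved by `τ` cancel in pairs and the fixed ones have even value.
  -- Since 9 is odd, the sum over `F` is odd.
  have hpar : (∑ i ∈ Fᶜ, (k i : ZMod 2)) = 0 := by
    refine Finset.sum_involution (fun i _ => τ i) (fun i _ => ?_) (fun i hi hne h => ?_)
      (fun i hi => ?_) (fun i _ => hτ i)
    · rw [hkτ]
      exact CharTwo.add_self_eq_zero _
    · rw [Finset.mem_compl, hF, not_and, Nat.not_odd_iff_even] at hi
      exact hne ((ZMod.natCast_eq_zero_iff_even).2 (hi h))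
    · rw [Finset.mem_compl, hF] at hi ⊢
      rw [hτ, hkτ]
      exact fun h => hi ⟨h.1.symm, h.2⟩
  have hodd : Odd (∑ i ∈ F, k i) := by
    rw [← Nat.cast_sum, ZMod.natCast_eq_zero_iff_even] at hpar
    rw [hk] at hsplit
    by_contra he
    rw [Nat.not_odd_iff_even] at he
    have := he.add hpar
    rw [hsplit] at this
    exact absurd this (by decide)
  have himg : ∑ n ∈ F.image k, n = ∑ i ∈ F, k i := Finset.sum_image hinj'
  rcases card_eq_one_or_eq_of_sum_le_nine (D := F.image k)
    (by simp only [Finset.mem_image, hF]; rintro _ ⟨i, hi, rfl⟩; exact hi.2)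
    (by omega) (by rwa [himg]) with h | h
  · left
    rw [Finset.card_image_of_injOn hinj', Finset.card_eq_one] at h
    obtain ⟨i₀, h⟩ := h
    have h0 := (hF i₀).1 (by simp [h])
    refine ⟨τ, hτ, hkτ, i₀, h0.1, h0.2, fun i hi hiτ => ?_⟩
    by_contra ho
    rw [Nat.not_even_iff_odd] at ho
    have := (hF i).2 ⟨hiτ, ho⟩
    rw [h, Finset.mem_singleton] at this
    exact hi this
  · right
    have hex : ∀ n ∈ ({1, 3, 5} : Finset ℕ), ∃ i, k i = n := fun n hn => by
      rw [← h, Finset.mem_image] at hn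
      obtain ⟨i, -, hi⟩ := hn
      exact ⟨i, hi⟩
    have hex' : ∀ a : Fin 3, ∃ i, k i = ![5, 3, 1] a := fun a =>
      hex _ (by fin_cases a <;> simp)
    choose s hs using hex'
    refine ⟨s, fun a a' haa => ?_, hs⟩
    have h1 := hs a
    rw [haa, hs a'] at h1
    have key : ∀ a a' : Fin 3, (![5, 3, 1] : Fin 3 → ℕ) a' = ![5, 3, 1] a → a = a' := by decide
    exact key a a' h1

/-! ### The dichotomy in dimension 9 and the classification. -/

/-- A nilpotent `9 × 9` matrix `A` has Jordan blocks of sizes `5, 3, 1`, or `g_A` is symplectic. -/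
theorem exists_isJordanBasis_or_admitsSymplecticStructure {A : Matrix (Fin 9) (Fin 9) ℝ}
    (hA : IsNilpotent A.mulVecLin) :
    AdmitsSymplecticStructure (AlmostAbelianAlg A) ∨
      ∃ b : Module.Basis ((i : Fin 3) × Fin (![5, 3, 1] i)) ℝ (Fin 9 → ℝ),
        IsJordanBasis A.mulVecLin b := by
  obtain ⟨n, k, b, hb⟩ := exists_isJordanBasis _ hA
  have hk : ∑ i, k i = 9 := by
    have := Module.finrank_eq_card_basis b
    simpa using this.symm
  rcases exists_pairing_or_five_three_one k hk with ⟨τ, hτ, hkτ, i₀, h1, h2, h3⟩ | ⟨s, hs, hks⟩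
  · exact Or.inl (hb.admitsSymplecticStructure hτ hkτ i₀ h1 h2 h3)
  -- As 5 + 3 + 1 = 9, all other chains have length zero and can be left out.
  · exact Or.inr (hb.exists_comp s hs hks (by rw [hk, Fin.sum_univ_three]; rfl))

theorem exists_hasLambda : ∃ M : Matrix (Fin 9) (Fin 9) ℝ,
    HasLambda M (.blocks [(5, 1), (3, 1)] 1) := by
  have e : ((i : Fin (JordanTuple.blocks [(5, 1), (3, 1)] 1).sizes.length) ×
      Fin ((JordanTuple.blocks [(5, 1), (3, 1)] 1).sizes.get i)) ≃ Fin 9 :=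
    Fintype.equivOfCardEq (by decide)
  exact ⟨_, by simp [JordanTuple.Mem], e, 1, rfl⟩

theorem HasLambda.exists_isJordanBasis {M : Matrix (Fin 9) (Fin 9) ℝ}
    (hM : HasLambda M (.blocks [(5, 1), (3, 1)] 1)) :
    ∃ b : Module.Basis ((i : Fin 3) × Fin (![5, 3, 1] i)) ℝ (Fin 9 → ℝ),
      IsJordanBasis M.mulVecLin b := by
  obtain ⟨-, e, P, hP⟩ := hM
  obtain ⟨b, hb⟩ := exists_isJordanBasis_of_conj _ e P hP
  refine hb.exists_comp (fun i : Fin 3 => i) (fun _ _ h => h) (fun a => ?_) rfl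
  fin_cases a <;> rfl

theorem corollary5p12 :
    (∃ M : Matrix (Fin 9) (Fin 9) ℝ, HasLambda M (.blocks [(5, 1), (3, 1)] 1)) ∧
    ∀ M : Matrix (Fin 9) (Fin 9) ℝ, HasLambda M (.blocks [(5, 1), (3, 1)] 1) →
      IsTenDimWithoutStructures (AlmostAbelianAlg M) ∧
      ∀ (g : Type*) [LieRing g] [LieAlgebra ℝ g], IsTenDimWithoutStructures g →
        Nonempty (g ≃ₗ⁅ℝ⁆ AlmostAbelianAlg M) := by
  refine ⟨exists_hasLambda, fun M hM => ?_⟩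
  obtain ⟨b, hb⟩ := hM.exists_isJordanBasis
  have hrank := fun m => (hb.finrank_range_pow m).trans (Fin.sum_univ_three _)
  refine ⟨⟨AlmostAbelianAlg.finrank_eq M, AlmostAbelianAlg.isNilpotent hb.isNilpotent,
    AlmostAbelianAlg.isAlmostAbelian M,
    AlmostAbelianAlg.not_admitsComplexStructure (hrank 3) (hrank 4),
    AlmostAbelianAlg.not_admitsSymplecticStructure (hrank 2) (hrank 4)⟩, ?_⟩
  rintro g _ _ ⟨hdim, hnil, hab, -, hsymp⟩
  obtain ⟨A, hA, ⟨e⟩⟩ := exists_lieEquiv_almostAbelianAlg hdim hnil hab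
  rcases exists_isJordanBasis_or_admitsSymplecticStructure hA with h | ⟨c, hc⟩
  · exact absurd (h.of_lieEquiv e) hsymp
  · obtain ⟨e'⟩ := AlmostAbelianAlg.nonempty_lieEquiv _ (hc.equiv_apply hb)
    exact ⟨e.trans e'⟩
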